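/- Let $\mathbb F$ be a field. An algebra is an $\mathbb F$-vector space $A$ with a bilinear multiplication $A\times A\to A$, $(x,y)\mapsto xy$ (no further condition is imposed); morphisms are the linear maps preserving the multiplication. A variety $\mathcal V$ is the class (and full subcategory) of all algebras satisfying a given set of identities $\varphi(x_1,\dots,x_n)=0$, where the $\varphi$ are non-associative polynomials over $\mathbb F$; it is *operadic* if it can be determined by a set of multilinear polynomials, i.e. polynomials $\varphi(x_1,\dots,x_n)$ in each of whose monomials every $x_i$ occurs exactly once. A subvariety of a variety is a variety contained in it. For an object $X$ of $\mathcal V$, let $\mathbf{SplExt}(X)$ be the category whose objects are the split extensions $X\xrightarrow{k}A\underset{\beta}{\overset{\alpha}{\rightleftarrows}}B$ in $\mathcal V$ (that is, $\alpha\beta=1_B$ and $k$ is a kernel of $\alpha$), and whose morphisms $(A,B,k,\alpha,\beta)\to(A',B',k',\alpha',\beta')$ are the pairs $f\colon A\to A'$, $g\colon B\to B'$ with $fk=k'$, $g\alpha=\alpha' f$, $f\beta=\beta' g$. An object of $\mathbf{SplExt}(X)$ is *faithful* if every object has at most one morphism into it. $\mathcal V$ is *action accessible* if, for every $X$ in $\mathcal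 V$, every object of $\mathbf{SplExt}(X)$ has a morphism into a faithful object. Let $\mathcal V$ be an action accessible, operadic variety of algebras over $\mathbb F$ which is not the variety of abelian algebras (the one determined by $xy=0$). 1. If all algebras in $\mathcal V$ are commutative ($xy=yx$), then $\mathcal V$ is a subvariety of $\mathbf{CAssoc}$ or a subvariety of $\mathbf{JJord}$ (or of both). 2. If all algebras in $\mathcal V$ are anti-commutative ($xy=-yx$), then $\mathcal V$ is a subvariety of $\mathbf{Lie}$ or a subvariety of $\mathbf{ACAAssoc}$ (or of both). Here $\mathbf{CAssoc}$ is the variety of commutative associative algebras; $\mathbf{JJord}$ is determined by $xy=yx$ and the Jacobi identity $x(yz)+y(zx)+z(xy)=0$; $\mathbf{Lie}$ is determined by $xy+yx=0$ and the Jacobi identity; and $\mathbf{ACAAssoc}$ is determined by $xy=-yx$ and $x(yz)=-(xy)z$. -/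

import Mathlib

open CategoryTheory CategoryTheory.Limits

universe w v u

/-! ### Split extensions and action accessibility in a pointed category -/

/-- A split extension `X --k--> A --α--> B`, `β : B ⟶ A`, with fixed kernel object `X`:
`α ∘ β = 1` and `k` is a kernel of `α`. These are the objects of the category `SplExt(X)`. -/
structure SplitExtension {C : Type u} [Category.{v} C] [HasZeroMorphisms C] (X : C) where
  A : C
  B : C
  k : X ⟶ A
  α : A ⟶ B
  β : B ⟶ A
  section_proj : β ≫ α = 𝟙 B
  zero : k ≫ α = 0
  isKernel : Nonempty (IsLimit (KernelFork.ofι k zero))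

/-- Morphisms of `SplExt(X)`: morphisms of extensions that are the identity on `X` and
commute with the sections. -/
@[ext]
structure SplitExtension.Hom {C : Type u} [Category.{v} C] [HasZeroMorphisms C] {X : C}
    (E E' : SplitExtension X) where
  f : E.A ⟶ E'.A
  g : E.B ⟶ E'.B
  comm_k : E.k ≫ f = E'.k
  comm_α : E.α ≫ g = f ≫ E'.α
  comm_β : E.β ≫ f = g ≫ E'.β

/-- A split extension is faithful if it is subterminal in `SplExt(X)`: each split extension
with kernel `X` has at most one morphism into it. -/
def SplitExtension.IsFaithful {C : Type u} [Category.{v} C] [HasZeroMorphisms C] {X : C}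
    (E : SplitExtension X) : Prop :=
  ∀ E' : SplitExtension X, Subsingleton (SplitExtension.Hom E' E)

/-- A category is action accessible if, for each object `X`, every split extension with kernel `X`
has a morphism in `SplExt(X)` into a faithful one. -/
def IsActionAccessible (C : Type u) [Category.{v} C] [HasZeroMorphisms C] : Prop :=
  ∀ (X : C) (E : SplitExtension X),
    ∃ E' : SplitExtension X, E'.IsFaithful ∧ Nonempty (SplitExtension.Hom E E')

/-! ### The category of non-associative algebras -/

/-- Non-associative algebras over `F`: vector spaces with a bilinear multiplication. -/
structure NAAlg (F : Type u) [Field F] : Type (u + 1) where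
  carrier : Type u
  [ring : NonUnitalNonAssocRing carrier]
  [module : Module F carrier]
  [isScalarTower : IsScalarTower F carrier carrier]
  [smulCommClass : SMulCommClass F carrier carrier]

instance {F : Type u} [Field F] : CoeSort (NAAlg F) (Type u) := ⟨NAAlg.carrier⟩

attribute [instance] NAAlg.ring NAAlg.module NAAlg.isScalarTower NAAlg.smulCommClass

/-- Morphisms are the linear maps that preserve the multiplication. -/
instance {F : Type u} [Field F] : Category.{u} (NAAlg F) where
  Hom A B := A →ₙₐ[F] B
  id A := NonUnitalAlgHom.id F A
  comp f g := NonUnitalAlgHom.comp g f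

instance {F : Type u} [Field F] : HasZeroMorphisms (NAAlg F) where
  zero A B := ⟨(0 : A →ₙₐ[F] B)⟩
  comp_zero _ _ := rfl
  zero_comp _ Y Z f := NonUnitalAlgHom.ext fun _ => map_zero (show Y →ₙₐ[F] Z from f)

/-! ### Identities and varieties

`FreeNonUnitalNonAssocAlgebra F S` is the magma algebra over `F` of the free magma on `S`. -/

/-- The multiset of letters of a non-associative word, with multiplicities. -/
def FreeMagma.letters {S : Type w} : FreeMagma S → Multiset S
  | .of x => {x}
  | .mul a b => a.letters + b.letters

/-- A non-associative polynomial is multilinear if there is a finite set `{x₁, …, xₙ}` of variables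
such that in each of its monomials each of `x₁, …, xₙ` occurs exactly once and no other variable
occurs. -/
def IsMultilinear {F : Type u} [Field F] {S : Type w}
    (φ : FreeNonUnitalNonAssocAlgebra F S) : Prop :=
  ∃ s : Finset S, ∀ m ∈ φ.coeff.support, m.letters = s.val

/-- `φ` is an identity of `A`: it vanishes under every substitution of elements of `A` for the
variables. -/
def NAAlg.Satisfies {F : Type u} [Field F] {S : Type w} (A : NAAlg F)
    (φ : FreeNonUnitalNonAssocAlgebra F S) : Prop :=
  ∀ a : S → A, FreeNonUnitalNonAssocAlgebra.lift F a φ = 0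

/-- The variety determined by a set `I` of polynomials: the class of all algebras that satisfy
all identities in `I`. -/
def NAAlg.variety {F : Type u} [Field F] {S : Type w}
    (I : Set (FreeNonUnitalNonAssocAlgebra F S)) : ObjectProperty (NAAlg F) :=
  fun A => ∀ φ ∈ I, A.Satisfies φ

/-- A class of algebras is an operadic variety if it is the variety determined by some set of
multilinear polynomials. -/
def IsOperadicVariety {F : Type u} [Field F] (V : ObjectProperty (NAAlg F)) : Prop :=
  ∃ (S : Type w) (I : Set (FreeNonUnitalNonAssocAlgebra F S)),
    (∀ φ ∈ I, IsMultilinear φ) ∧ V = NAAlg.variety I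

/-! ### The varieties that occur in the statement

A variety is a subvariety of another one when it is contained in it, which is `≤`
on `ObjectProperty`. -/

/-- Abelian algebras: `xy = 0`. -/
def AbAlg (F : Type u) [Field F] : ObjectProperty (NAAlg F) :=
  fun A => ∀ x y : A, x * y = 0

/-- Commutative algebras: `xy = yx`. -/
def Com (F : Type u) [Field F] : ObjectProperty (NAAlg F) :=
  fun A => ∀ x y : A, x * y = y * x

/-- Anti-commutative algebras: `xy = -yx`. -/
def ACom (F : Type u) [Field F] : ObjectProperty (NAAlg F) :=
  fun A => ∀ x y : A, x * y = -(y * x)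

/-- Commutative associative algebras. -/
def CAssoc (F : Type u) [Field F] : ObjectProperty (NAAlg F) :=
  fun A => (∀ x y : A, x * y = y * x) ∧ ∀ x y z : A, x * (y * z) = (x * y) * z

/-- Jacobi–Jordan algebras: commutativity and the Jacobi identity. -/
def JJord (F : Type u) [Field F] : ObjectProperty (NAAlg F) :=
  fun A => (∀ x y : A, x * y = y * x) ∧
    ∀ x y z : A, x * (y * z) + y * (z * x) + z * (x * y) = 0

/-- Lie algebras, in the sense of anti-commutativity `xy + yx = 0` (not `xx = 0`) and the Jacobi
identity. -/
def LieVar (F : Type u) [Field F] : ObjectProperty (NAAlg F) :=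
  fun A => (∀ x y : A, x * y + y * x = 0) ∧
    ∀ x y z : A, x * (y * z) + y * (z * x) + z * (x * y) = 0

/-- Anti-commutative anti-associative algebras. -/
def ACAAssoc (F : Type u) [Field F] : ObjectProperty (NAAlg F) :=
  fun A => (∀ x y : A, x * y = -(y * x)) ∧ ∀ x y z : A, x * (y * z) = -((x * y) * z)

/-! ### Closure properties of varieties -/

namespace FreeNonUnitalNonAssocAlgebra

variable {F : Type u} [Field F] {S : Type w}

/-! Write the symmetry as `xy = ε(yx)` with `ε = ±1`. In a faithful split extension, elements acting
trivially on the kernel `X` must vanish, so action accessibility forces the elements of `B` that act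
trivially on `X` to behave like an ideal (`mul_eq_zero_of_isActionAccessible`). This fails in a
five-dimensional test algebra, where `s` kills `X` but `sb` does not, so `V` omits that algebra.

If `(ab)c` were not in the span of `a(bc)` and `b(ac)` for some `a, b, c` in an algebra `A` of `V`,
the test algebra would be a subquotient of `A[ε₁, ε₂, ε₃]`, which lies in `V` because multilinear
identities survive adjoining `ε` with `ε² = 0` (`test_of_notMem_span`). Hence `(ab)c` always lies in
this span. Passing to a power of `A` makes the coefficients the same for all orderings of `a, b, c`.
Linear algebra then gives `(ab)c = (bc)a` or a vanishing cyclic sum, and passing to products makes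
one alternative hold throughout `V`. -/

theorem map_lift {A B : Type*} [NonUnitalNonAssocRing A] [Module F A] [IsScalarTower F A A]
    [SMulCommClass F A A] [NonUnitalNonAssocRing B] [Module F B] [IsScalarTower F B B]
    [SMulCommClass F B B] (g : A →ₙₐ[F] B) (a : S → A) (φ : FreeNonUnitalNonAssocAlgebra F S) :
    g (lift F a φ) = lift F (g ∘ a) φ := by
  have : g.comp (lift F a) = lift F (g ∘ a) := by
    refine hom_ext F fun x => ?_
    simp
  exact DFunLike.congr_fun this φ

theorem lift_apply {A : Type*} [NonUnitalNonAssocRing A] [Module F A] [IsScalarTower F A A]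
    [SMulCommClass F A A] (a : S → A) (φ : FreeNonUnitalNonAssocAlgebra F S) :
    lift F a φ = ∑ m ∈ φ.coeff.support, φ.coeff m • FreeMagma.lift a m := rfl

end FreeNonUnitalNonAssocAlgebra

namespace NAAlg

open FreeNonUnitalNonAssocAlgebra

variable {F : Type u} [Field F] {S : Type w}

theorem Satisfies.of_separating {P : NAAlg F} {φ : FreeNonUnitalNonAssocAlgebra F S}
    (h : ∀ p, (∀ (A : NAAlg F) (g : P →ₙₐ[F] A), A.Satisfies φ → g p = 0) → p = 0) :
    P.Satisfies φ := fun a =>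
  h _ fun _ g hA => (map_lift g a φ).trans (hA _)

/-- An algebra linked to `D` by a total, functional multiplicative relation inherits the identities
of `D`. -/
theorem Satisfies.of_rel {E D : NAAlg F} {φ : FreeNonUnitalNonAssocAlgebra F S}
    (hD : D.Satisfies φ) (R : NonUnitalSubalgebra F (E × D)) (total : ∀ e, ∃ d, (e, d) ∈ R)
    (zero : ∀ e, (e, 0) ∈ R → e = 0) : E.Satisfies φ := by
  intro a
  choose d hd using fun s => total (a s)
  -- Evaluating `φ` inside `R` and projecting to both factors puts the pair of values at `a` and `d`
  -- in `R`; the second value is zero.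
  let h : S → R := fun s => ⟨(a s, d s), hd s⟩
  have h₁ := map_lift ((NonUnitalAlgHom.fst F E D).comp (NonUnitalSubalgebraClass.subtype R)) h φ
  have h₂ := map_lift ((NonUnitalAlgHom.snd F E D).comp (NonUnitalSubalgebraClass.subtype R)) h φ
  have h₃ := (lift F h φ).2
  have e₁ : (lift F h φ).1.1 = lift F a φ := h₁
  have e₂ : (lift F h φ).1.2 = lift F d φ := h₂
  rw [hD d] at e₂
  exact zero _ (by rw [← e₁, ← e₂]; exact h₃)

/-- The ring structure given by a bilinear map. -/
abbrev bilinRing {M : Type u} [AddCommGroup M] [Module F M] (μ : M →ₗ[F] M →ₗ[F] M) :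
    NonUnitalNonAssocRing M :=
  { (inferInstance : AddCommGroup M) with
    mul := fun x y => μ x y
    left_distrib := fun x y z => map_add (μ x) y z
    right_distrib := fun x y z => LinearMap.map_add₂ μ x y z
    zero_mul := fun x => LinearMap.map_zero₂ μ x
    mul_zero := fun x => map_zero (μ x) }

/-- The algebra given by a bilinear map. -/
def ofBilin {M : Type u} [AddCommGroup M] [Module F M] (μ : M →ₗ[F] M →ₗ[F] M) : NAAlg F :=
  letI := bilinRing μ
  { carrier := M
    ring := bilinRing μ
    module := (inferInstance : Module F M)
    isScalarTower := ⟨fun r x y => LinearMap.map_smul₂ μ r x y⟩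
    smulCommClass := ⟨fun r x y => (LinearMap.map_smul (μ x) r y).symm⟩ }

/-! ### Dual numbers and multilinear identities -/

/-- The multiplication `(x, x') (y, y') = (x y, x y' + x' y)` of `A[ε]`, `ε² = 0`. -/
def dualMul (A : NAAlg F) : A × A →ₗ[F] A × A →ₗ[F] A × A :=
  LinearMap.mk₂ F (fun x y => (x.1 * y.1, x.1 * y.2 + x.2 * y.1))
    (fun x y z => by ext <;> simp [add_mul]; abel)
    (fun c x y => by ext <;> simp [smul_mul_assoc])
    (fun x y z => by ext <;> simp [mul_add]; abel)
    (fun c x y => by ext <;> simp [mul_smul_comm])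

/-- The algebra `A[ε]` of dual numbers over `A`. -/
def dual (A : NAAlg F) : NAAlg F := ofBilin A.dualMul

/-- This is the Leibniz rule. Since no letter repeats, differentiating at a letter amounts to
changing the value substituted for it. -/
theorem lift_dual (A : NAAlg F) [DecidableEq S] (a : S → A × A) (m : FreeMagma S)
    (hm : m.letters.Nodup) :
    (FreeMagma.lift (β := A.dual) a m : A × A) = (FreeMagma.lift (fun i => (a i).1) m,
      (m.letters.map fun i =>
        FreeMagma.lift (Function.update (fun i => (a i).1) i (a i).2) m).sum) := by
  have indep (m : FreeMagma S) (i : S) (b : S → A) (c : A) : i ∉ m.letters →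
      FreeMagma.lift (Function.update b i c) m = FreeMagma.lift b m := by
    induction m with
    | ih1 x =>
      intro h
      have h' : i ≠ x := by simpa [FreeMagma.letters] using h
      exact Function.update_of_ne h'.symm _ _
    | ih2 u v hu hv =>
      intro h
      have h' : i ∉ u.letters ∧ i ∉ v.letters := by
        simpa [FreeMagma.letters] using h
      have := congrArg₂ (· * ·) (hu h'.1) (hv h'.2)
      exact (map_mul _ u v).trans (this.trans (map_mul _ u v).symm)
  induction m with
  | ih1 x =>
    show a x = ((a x).1, (({x} : Multiset S).map _).sum)
    simp
  | ih2 u v hu hv =>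
    have hn : u.letters.Nodup ∧ v.letters.Nodup ∧ Disjoint u.letters v.letters :=
      Multiset.nodup_add.1 hm
    have hdis : ∀ i ∈ u.letters, i ∉ v.letters := fun _ => Multiset.disjoint_left.1 hn.2.2
    specialize hu hn.1
    specialize hv hn.2.1
    have key : ∀ x y : A × A, ((show A.dual from x) * (show A.dual from y) : A.dual) =
      (x.1 * y.1, x.1 * y.2 + x.2 * y.1) := fun _ _ => rfl
    refine (map_mul _ u v).trans ?_
    refine (key _ _).trans ?_
    rw [hu, hv]
    show _ = ((FreeMagma.lift (fun i => (a i).1)) (u * v), ((u.letters + v.letters).map fun i =>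
        FreeMagma.lift (Function.update (fun i => (a i).1) i (a i).2) (u * v)).sum)
    simp only [map_mul, Multiset.map_add, Multiset.sum_add]
    rw [add_comm, ← Multiset.sum_map_mul_right, ← Multiset.sum_map_mul_left]
    congr 3
    · refine Multiset.map_congr rfl fun i hi => ?_
      rw [indep v _ _ _ (hdis i hi)]
    · refine Multiset.map_congr rfl fun i hi => ?_
      rw [indep u _ _ _ (fun h => hdis i h hi)]

/-- All monomials of `φ` have the same letters, so the `ε`-component is a sum, over these letters,
of values of `φ` in `A`. -/
theorem Satisfies.dual {A : NAAlg F} {φ : FreeNonUnitalNonAssocAlgebra F S}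
    (hA : A.Satisfies φ) (hφ : IsMultilinear φ) : A.dual.Satisfies φ := by
  classical
  obtain ⟨s, hs⟩ := hφ
  suffices ∀ (a : S → A × A) (w : FreeMagma S → A × A),
      (∀ m, w m = FreeMagma.lift (β := A.dual) a m) →
      ∑ m ∈ φ.coeff.support, φ.coeff m • w m = 0 from fun a => this a _ fun _ => rfl
  intro a w hw
  rw [Finset.sum_congr rfl fun m hm => by
    rw [hw, lift_dual A a m (by rw [hs m hm]; exact s.nodup), hs m hm]]
  refine Prod.ext ?_ ?_
  · rw [Prod.fst_sum]
    exact hA fun i => (a i).1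
  · rw [Prod.snd_sum]
    have : ∀ m, (s.val.map fun i => FreeMagma.lift
        (Function.update (fun i => (a i).1) i (a i).2) m).sum =
        ∑ i ∈ s, FreeMagma.lift (Function.update (fun i => (a i).1) i (a i).2) m :=
      fun m => rfl
    simp only [Prod.smul_snd, this, Finset.smul_sum]
    rw [Finset.sum_comm]
    exact Finset.sum_eq_zero fun i _ => hA _

end NAAlg

/-! ### Closure of operadic varieties -/

namespace IsOperadicVariety

variable {F : Type u} [Field F] {V : ObjectProperty (NAAlg F)}

theorem of_separating (hV : IsOperadicVariety.{w} V) {P : NAAlg F}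
    (h : ∀ p : P, (∀ (A : NAAlg F) (g : P →ₙₐ[F] A), V A → g p = 0) → p = 0) : V P := by
  obtain ⟨S, I, -, rfl⟩ := hV
  exact fun φ hφ => .of_separating fun p hp => h p fun A g hA => hp A g (hA φ hφ)

theorem of_injective (hV : IsOperadicVariety.{w} V) {P A : NAAlg F} (hA : V A) (g : P →ₙₐ[F] A)
    (hg : ∀ p, g p = 0 → p = 0) : V P :=
  hV.of_separating fun p hp => hg p (hp A g hA)

theorem of_rel (hV : IsOperadicVariety.{w} V) {E D : NAAlg F} (hD : V D)
    (R : NonUnitalSubalgebra F (E × D)) (total : ∀ e, ∃ d, (e, d) ∈ R)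
    (zero : ∀ e, (e, 0) ∈ R → e = 0) : V E := by
  obtain ⟨S, I, -, rfl⟩ := hV
  exact fun φ hφ => .of_rel (hD φ hφ) R total zero

theorem dual (hV : IsOperadicVariety.{w} V) {A : NAAlg F} (hA : V A) : V A.dual := by
  obtain ⟨S, I, hI, rfl⟩ := hV
  exact fun φ hφ => (hA φ hφ).dual (hI φ hφ)

theorem pi (hV : IsOperadicVariety.{w} V) {ι : Type u} {A : ι → NAAlg F} (hA : ∀ i, V (A i)) :
    V ⟨∀ i, A i⟩ :=
  hV.of_separating fun _ hp => funext fun i =>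
    hp (A i)
      { toFun := fun p => p i
        map_smul' := fun _ _ => rfl
        map_zero' := rfl
        map_add' := fun _ _ => rfl
        map_mul' := fun _ _ => rfl } (hA i)

theorem prod (hV : IsOperadicVariety.{w} V) {A B : NAAlg F} (hA : V A) (hB : V B) :
    V ⟨A × B⟩ :=
  hV.of_separating fun _ hp => Prod.ext
    (hp A (NonUnitalAlgHom.fst F A B) hA) (hp B (NonUnitalAlgHom.snd F A B) hB)

end IsOperadicVariety

/-! ### Consequences of action accessibility -/

namespace NAAlg

variable {F : Type u} [Field F] {V : ObjectProperty (NAAlg F)}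

/-- A split epimorphism of algebras with a kernel, as a split extension. -/
def splitExtension {X A B : NAAlg F} (hX : V X) (hA : V A) (hB : V B) (k : X →ₙₐ[F] A)
    (p : A →ₙₐ[F] B) (i : B →ₙₐ[F] A) (hpi : ∀ b, p (i b) = b) (hk : Function.Injective k)
    (hker : ∀ a, p a = 0 ↔ ∃ x, k x = a) :
    SplitExtension (C := V.FullSubcategory) ⟨X, hX⟩ where
  A := ⟨A, hA⟩
  B := ⟨B, hB⟩
  k := ObjectProperty.homMk k
  α := ObjectProperty.homMk p
  β := ObjectProperty.homMk i
  section_proj := ObjectProperty.hom_ext _ (NonUnitalAlgHom.ext hpi)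
  zero := ObjectProperty.hom_ext _ (NonUnitalAlgHom.ext fun x => (hker _).2 ⟨x, rfl⟩)
  isKernel := by
    refine ⟨KernelFork.IsLimit.ofι _ _ (fun {W} g hg => ObjectProperty.homMk ?_) ?_ ?_⟩
    · have h : ∀ y, ∃ x, k x = (show W.obj →ₙₐ[F] A from g.hom) y := fun y =>
        (hker _).1 (DFunLike.congr_fun
          (show (p.comp (show W.obj →ₙₐ[F] A from g.hom)) = 0 from congrArg (·.hom) hg) y)
      choose l hl using h
      exact
        { toFun := l
          map_smul' := fun r y => hk (by simp [hl])
          map_zero' := hk (by simp [hl])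
          map_add' := fun y z => hk (by simp [hl])
          map_mul' := fun y z => hk (by simp [hl]) }
    · intro W g hg
      refine ObjectProperty.hom_ext _ (NonUnitalAlgHom.ext fun y => ?_)
      exact Exists.choose_spec (p := fun x => k x = (show W.obj →ₙₐ[F] A from g.hom) y) _
    · intro W g hg m hm
      refine ObjectProperty.hom_ext _ (NonUnitalAlgHom.ext fun y => hk ?_)
      refine (DFunLike.congr_fun (show k.comp (show W.obj →ₙₐ[F] X from m.hom) =
        (show W.obj →ₙₐ[F] A from g.hom) from congrArg (·.hom) hm) y).trans ?_
      exact (Exists.choose_spec (p := fun x => k x = (show W.obj →ₙₐ[F] A from g.hom) y) _).symm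

/-- The set-theoretic kernel is a subalgebra, hence in `V`; its inclusion and the zero map agree
after composition with `f`. -/
theorem eq_zero_of_mono (hV : IsOperadicVariety.{w} V) {X Y : V.FullSubcategory} (f : X ⟶ Y)
    [Mono f] (x : X.obj) (hx : (show X.obj →ₙₐ[F] Y.obj from f.hom) x = 0) : x = 0 := by
  let φ : X.obj →ₙₐ[F] Y.obj := f.hom
  let K : NonUnitalSubalgebra F X.obj :=
    { carrier := {x | φ x = 0}
      add_mem' := fun {x y} hx hy => (map_add φ x y).trans (by rw [hx, hy, add_zero])
      zero_mem' := map_zero φ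
      mul_mem' := fun {x y} hx _ => (map_mul φ x y).trans (by rw [hx, zero_mul])
      smul_mem' := fun r x hx => (map_smul φ r x).trans (by rw [hx, smul_zero]) }
  let ι : K →ₙₐ[F] X.obj := NonUnitalSubalgebraClass.subtype K
  have hK : V ⟨K⟩ := hV.of_injective (P := ⟨K⟩) X.property ι fun p hp => Subtype.ext hp
  have h : (ObjectProperty.homMk (P := V) (X := ⟨⟨K⟩, hK⟩) (Y := X) ι) = 0 := by
    rw [← cancel_mono f, zero_comp]
    exact ObjectProperty.hom_ext _ (NonUnitalAlgHom.ext fun y => y.2)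
  exact DFunLike.congr_fun (show ι = 0 from congrArg (·.hom) h) ⟨x, hx⟩

/-- In an action accessible variety, the ideal of `B` generated by a subalgebra which annihilates
the kernel `X` of a split extension annihilates `X`. -/
theorem mul_eq_zero_of_isActionAccessible (hV : IsOperadicVariety.{w} V)
    (hacc : IsActionAccessible V.FullSubcategory) {S X A B : NAAlg F} (hS : V S) (hX : V X)
    (hA : V A) (hB : V B) (k : X →ₙₐ[F] A)
    (p : A →ₙₐ[F] B) (i : B →ₙₐ[F] A) (hpi : ∀ b, p (i b) = b) (hk : Function.Injective k)
    (hker : ∀ a, p a = 0 ↔ ∃ x, k x = a) (j : S →ₙₐ[F] B)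
    (hl : ∀ s x, i (j s) * k x = 0) (hr : ∀ s x, k x * i (j s) = 0) (s : S) (b : B) (x : X) :
    i (j s * b) * k x = 0 := by
  obtain ⟨E, hE, ⟨h⟩⟩ := hacc ⟨X, hX⟩ (splitExtension hX hA hB k p i hpi hk hker)
  -- The extension of `S` by `X` with trivial action. It receives two candidate maps to `E`: one
  -- through `g ∘ j`, one that is zero on `S`.
  let E' : SplitExtension (C := V.FullSubcategory) ⟨X, hX⟩ :=
    splitExtension hX (hV.prod hS hX) hS (A := ⟨S × X⟩) (NonUnitalAlgHom.inr F S X)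
      (NonUnitalAlgHom.fst F S X) (NonUnitalAlgHom.inl F S X) (fun _ => rfl)
      (fun x y h => congrArg Prod.snd h)
      (fun a => ⟨fun h => ⟨a.2, Prod.ext (Eq.symm h) rfl⟩, by rintro ⟨x, rfl⟩; rfl⟩)
  let f : A →ₙₐ[F] E.A.obj := h.f.hom
  let g : B →ₙₐ[F] E.B.obj := h.g.hom
  let k' : X →ₙₐ[F] E.A.obj := E.k.hom
  let p' : E.A.obj →ₙₐ[F] E.B.obj := E.α.hom
  let i' : E.B.obj →ₙₐ[F] E.A.obj := E.β.hom
  have hfk : ∀ x, f (k x) = k' x := DFunLike.congr_fun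
    (show f.comp k = k' from congrArg (·.hom) h.comm_k)
  have hpf : ∀ a, g (p a) = p' (f a) := DFunLike.congr_fun
    (show g.comp p = p'.comp f from congrArg (·.hom) h.comm_α)
  have hfi : ∀ b, f (i b) = i' (g b) := DFunLike.congr_fun
    (show f.comp i = i'.comp g from congrArg (·.hom) h.comm_β)
  have hpk' : ∀ x, p' (k' x) = 0 := DFunLike.congr_fun
    (show p'.comp k' = 0 from congrArg (·.hom) E.zero)
  have hsk : ∀ s x, i' (g (j s)) * k' x = 0 := fun s x => by
    rw [← hfk, ← hfi, ← map_mul, hl, map_zero]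
  have hks : ∀ s x, k' x * i' (g (j s)) = 0 := fun s x => by
    rw [← hfk, ← hfi, ← map_mul, hr, map_zero]
  have hpi' : ∀ b, p' (i' b) = b := DFunLike.congr_fun
    (show p'.comp i' = NonUnitalAlgHom.id F _ from congrArg (·.hom) E.section_proj)
  let f₁ : S × X →ₙₐ[F] E.A.obj :=
    { toFun := fun z => i' (g (j z.1)) + k' z.2
      map_smul' := fun r z => by simp
      map_zero' := by simp
      map_add' := fun y z => by simp; abel
      map_mul' := fun y z => by simp [mul_add, add_mul, hsk, hks] }
  let f₂ : S × X →ₙₐ[F] E.A.obj := k'.comp (NonUnitalAlgHom.snd F S X)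
  let m₁ : E'.Hom E :=
    { f := ObjectProperty.homMk f₁
      g := ObjectProperty.homMk (g.comp j)
      comm_k := ObjectProperty.hom_ext _ (NonUnitalAlgHom.ext fun x => by
        show i' (g (j 0)) + k' x = k' x
        simp)
      comm_α := ObjectProperty.hom_ext _ (NonUnitalAlgHom.ext fun z => by
        show g (j z.1) = p' (i' (g (j z.1)) + k' z.2)
        simp [hpk', hpi'])
      comm_β := ObjectProperty.hom_ext _ (NonUnitalAlgHom.ext fun s => by
        show i' (g (j s)) + k' 0 = i' (g (j s))
        simp) }
  let m₂ : E'.Hom E :=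
    { f := ObjectProperty.homMk f₂
      g := 0
      comm_k := rfl
      comm_α := ObjectProperty.hom_ext _ (NonUnitalAlgHom.ext fun z => (hpk' z.2).symm)
      comm_β := ObjectProperty.hom_ext _ (NonUnitalAlgHom.ext fun s => by
        show k' 0 = i' 0
        simp) }
  -- Faithfulness of `E` identifies the two morphisms.
  have hgj : g (j s) = 0 := DFunLike.congr_fun (show g.comp j = 0 from
    congrArg (·.g.hom) ((hE E').elim m₁ m₂)) s
  -- The product lies in the kernel, on which `f` is injective because `k'` is; and `f` sends it to
  -- zero.
  obtain ⟨y, hy⟩ := (hker (i (j s * b) * k x)).1 (by rw [map_mul, (hker _).2 ⟨x, rfl⟩, mul_zero])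
  have hmono : Mono E.k := mono_of_isLimit_fork E.isKernel.some
  have hy0 : y = 0 := eq_zero_of_mono hV E.k y (by
    refine (hfk y).symm.trans ?_
    rw [hy, map_mul, hfi, map_mul, hgj, zero_mul, map_zero, zero_mul])
  rw [← hy, hy0, map_zero]

/-! ### The test algebra is excluded -/

/-- The multiplication of the `ε`-commutative algebra with basis `s, b, sb, x, (sb)x`, in which
all other products of basis elements vanish. -/
def testMul (ε : F) : (F × F × F) × (F × F) →ₗ[F] (F × F × F) × (F × F) →ₗ[F]
    (F × F × F) × (F × F) :=
  LinearMap.mk₂ F (fun u v => ((0, 0, u.1.1 * v.1.2.1 + ε * (u.1.2.1 * v.1.1)),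
      (0, u.1.2.2 * v.2.1 + ε * (u.2.1 * v.1.2.2))))
    (fun x y z => by ext <;> simp <;> ring)
    (fun c x y => by ext <;> simp <;> ring)
    (fun x y z => by ext <;> simp <;> ring)
    (fun c x y => by ext <;> simp <;> ring)

/-- The multiplication of the subalgebra with basis `s, b, sb`. -/
def testQuotMul (ε : F) : F × F × F →ₗ[F] F × F × F →ₗ[F] F × F × F :=
  LinearMap.mk₂ F (fun u v => (0, 0, u.1 * v.2.1 + ε * (u.2.1 * v.1)))
    (fun x y z => by ext <;> simp; ring)
    (fun c x y => by ext <;> simp; ring)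
    (fun x y z => by ext <;> simp; ring)
    (fun c x y => by ext <;> simp; ring)

/-- The homomorphism given by a linear map compatible with the bilinear maps. -/
def homOfBilin {M N : Type u} [AddCommGroup M] [Module F M] [AddCommGroup N] [Module F N]
    {μ : M →ₗ[F] M →ₗ[F] M} {ν : N →ₗ[F] N →ₗ[F] N} (l : M →ₗ[F] N)
    (h : ∀ x y, l (μ x y) = ν (l x) (l y)) : ofBilin μ →ₙₐ[F] ofBilin ν where
  toFun := l
  map_smul' := map_smul l
  map_zero' := map_zero l
  map_add' := map_add l
  map_mul' := h

/-- Take `X` spanned by `x, (sb)x`, `B` by `s, b, sb` and `S` by `s`. Then `s` annihilates `X` on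
both sides, yet `(sb)x ≠ 0`. -/
theorem not_test_of_isActionAccessible (hV : IsOperadicVariety.{w} V)
    (hacc : IsActionAccessible V.FullSubcategory) (ε : F) : ¬ V (ofBilin (testMul ε)) := by
  intro hA
  let k : ofBilin (0 : F × F →ₗ[F] F × F →ₗ[F] F × F) →ₙₐ[F] ofBilin (testMul ε) :=
    homOfBilin (LinearMap.inr F (F × F × F) (F × F)) fun x y => by simp [testMul, Prod.ext_iff]
  let p : ofBilin (testMul ε) →ₙₐ[F] ofBilin (testQuotMul ε) :=
    homOfBilin (LinearMap.fst F (F × F × F) (F × F)) fun x y => by simp [testMul, testQuotMul]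
  let i : ofBilin (testQuotMul ε) →ₙₐ[F] ofBilin (testMul ε) :=
    homOfBilin (LinearMap.inl F (F × F × F) (F × F)) fun x y => by
      simp [testMul, testQuotMul, Prod.ext_iff]
  let j : ofBilin (0 : F →ₗ[F] F →ₗ[F] F) →ₙₐ[F] ofBilin (testQuotMul ε) :=
    homOfBilin (LinearMap.inl F F (F × F)) fun x y => by simp [testQuotMul, Prod.ext_iff]
  have hX := hV.of_injective hA k fun x hx => congrArg Prod.snd hx
  have hB := hV.of_injective hA i fun x hx => congrArg Prod.fst hx
  have hS := hV.of_injective hB j fun x hx => congrArg Prod.fst hx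
  have hl : ∀ (s : F) (x : F × F), testMul ε ((s, 0, 0), 0) (0, x) = 0 := fun s x => by
    simp [testMul]
  have hr : ∀ (s : F) (x : F × F), testMul ε (0, x) ((s, 0, 0), 0) = 0 := fun s x => by
    simp [testMul]
  have h : testMul ε (testQuotMul ε (1, 0, 0) (0, 1, 0), 0) (0, 1, 0) = 0 :=
    mul_eq_zero_of_isActionAccessible hV hacc hS hX hA hB k p i (fun _ => rfl)
      (fun x y h => congrArg Prod.snd h)
      (fun a => ⟨fun h => ⟨Prod.snd a, Prod.ext (Eq.symm h) rfl⟩, by rintro ⟨x, rfl⟩; rfl⟩) j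
      hl hr (1 : F) ((0, 1, 0) : F × F × F) ((1, 0) : F × F)
  simp [testMul, testQuotMul] at h

/-! ### The test algebra as a subquotient of triple dual numbers -/

/-- The component of `1` in `A[ε]`. -/
def dualFst (A : NAAlg F) : A.dual →ₗ[F] A := LinearMap.fst F A A

/-- The component of `ε` in `A[ε]`. -/
def dualSnd (A : NAAlg F) : A.dual →ₗ[F] A := LinearMap.snd F A A

theorem dualFst_mul (A : NAAlg F) (x y : A.dual) :
    A.dualFst (x * y) = A.dualFst x * A.dualFst y := rfl

theorem dualSnd_mul (A : NAAlg F) (x y : A.dual) :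
    A.dualSnd (x * y) = A.dualFst x * A.dualSnd y + A.dualSnd x * A.dualFst y := rfl

/-- In `A[ε₁, ε₂, ε₃]` the elements `ε₁a, ε₂b, ε₃c` play the roles of `s, b, x`. The unwanted
products `ε₁ε₃ac` and `ε₂ε₃bc` can be sent to zero provided that what they generate in degree
`ε₁ε₂ε₃` misses `(ab)c`. -/
theorem test_of_notMem_span (hV : IsOperadicVariety.{w} V) {A : NAAlg F} (hA : V A) (ε : F)
    (hε : ∀ x y : A, x * y = ε • (y * x)) (a b c : A)
    (h : (a * b) * c ∉ Submodule.span F {a * (b * c), b * (a * c)}) :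
    V (ofBilin (testMul ε)) := by
  obtain ⟨f, hf, hfs⟩ := Submodule.exists_le_ker_of_notMem h
  have hq : f (a * (b * c)) = 0 := hfs (Submodule.subset_span (by simp))
  have hr : f (b * (a * c)) = 0 := hfs (Submodule.subset_span (by simp))
  have hp0 : a * b * c ≠ 0 := fun h0 => hf (by rw [h0, map_zero])
  have hab0 : a * b ≠ 0 := fun h0 => hp0 (by rw [h0, zero_mul])
  have hc0 : c ≠ 0 := fun h0 => hp0 (by rw [h0, mul_zero])
  have ha0 : a ≠ 0 := fun h0 => hab0 (by rw [h0, zero_mul])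
  have hb0 : b ≠ 0 := fun h0 => hab0 (by rw [h0, mul_zero])
  let D := A.dual.dual.dual
  let E := ofBilin (testMul ε)
  -- Coefficients of the monomials in `ε₁, ε₂, ε₃`, with `ε₁` the innermost and `ε₃` the outermost
  -- dual variable.
  let c₀ : D →ₗ[F] A := A.dualFst ∘ₗ A.dual.dualFst ∘ₗ A.dual.dual.dualFst
  let c₁ : D →ₗ[F] A := A.dualSnd ∘ₗ A.dual.dualFst ∘ₗ A.dual.dual.dualFst
  let c₂ : D →ₗ[F] A := A.dualFst ∘ₗ A.dual.dualSnd ∘ₗ A.dual.dual.dualFst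
  let c₁₂ : D →ₗ[F] A := A.dualSnd ∘ₗ A.dual.dualSnd ∘ₗ A.dual.dual.dualFst
  let c₃ : D →ₗ[F] A := A.dualFst ∘ₗ A.dual.dualFst ∘ₗ A.dual.dual.dualSnd
  let c₁₃ : D →ₗ[F] A := A.dualSnd ∘ₗ A.dual.dualFst ∘ₗ A.dual.dual.dualSnd
  let c₂₃ : D →ₗ[F] A := A.dualFst ∘ₗ A.dual.dualSnd ∘ₗ A.dual.dual.dualSnd
  let c₁₂₃ : D →ₗ[F] A := A.dualSnd ∘ₗ A.dual.dualSnd ∘ₗ A.dual.dual.dualSnd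
  let W : Type u := (F × F × F) × (F × F)
  -- The graph of the quotient map: multiples of `ac` and `bc` are left free and forgotten, and the
  -- top coefficient matters only modulo the kernel of `f`.
  let P : W → D → Prop := fun e d =>
    c₀ d = 0 ∧ c₁ d = e.1.1 • a ∧ c₂ d = e.1.2.1 • b ∧ c₁₂ d = e.1.2.2 • (a * b) ∧
    c₃ d = e.2.1 • c ∧ (∃ t : F, c₁₃ d = t • (a * c)) ∧ (∃ t : F, c₂₃ d = t • (b * c)) ∧
    f (c₁₂₃ d) = e.2.2 * f (a * b * c)
  have P_add : ∀ e e' d d', P e d → P e' d' → P (e + e') (d + d') := by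
    rintro e e' d d' ⟨h₀, h₁, h₂, h₁₂, h₃, ⟨t, h₁₃⟩, ⟨s, h₂₃⟩, h₁₂₃⟩
      ⟨h₀', h₁', h₂', h₁₂', h₃', ⟨t', h₁₃'⟩, ⟨s', h₂₃'⟩, h₁₂₃'⟩
    refine ⟨?_, ?_, ?_, ?_, ?_, ⟨t + t', ?_⟩, ⟨s + s', ?_⟩, ?_⟩ <;> rw [map_add]
    · rw [h₀, h₀', add_zero]
    · rw [h₁, h₁', ← add_smul]; rfl
    · rw [h₂, h₂', ← add_smul]; rfl
    · rw [h₁₂, h₁₂', ← add_smul]; rfl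
    · rw [h₃, h₃', ← add_smul]; rfl
    · rw [h₁₃, h₁₃', ← add_smul]
    · rw [h₂₃, h₂₃', ← add_smul]
    · rw [map_add, h₁₂₃, h₁₂₃', ← add_mul]; rfl
  have P_smul : ∀ (r : F) e d, P e d → P (r • e) (r • d) := by
    rintro r e d ⟨h₀, h₁, h₂, h₁₂, h₃, ⟨t, h₁₃⟩, ⟨s, h₂₃⟩, h₁₂₃⟩
    refine ⟨?_, ?_, ?_, ?_, ?_, ⟨r * t, ?_⟩, ⟨r * s, ?_⟩, ?_⟩ <;> rw [map_smul]
    · rw [h₀, smul_zero]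
    · rw [h₁, smul_smul]; rfl
    · rw [h₂, smul_smul]; rfl
    · rw [h₁₂, smul_smul]; rfl
    · rw [h₃, smul_smul]; rfl
    · rw [h₁₃, smul_smul]
    · rw [h₂₃, smul_smul]
    · rw [map_smul, h₁₂₃, smul_eq_mul, ← mul_assoc]; rfl
  have P_zero : P 0 0 := by
    refine ⟨map_zero _, ?_, ?_, ?_, ?_, ⟨0, ?_⟩, ⟨0, ?_⟩, ?_⟩ <;> simp [W]
  have P_mul : ∀ e e' d d', P e d → P e' d' → P (testMul ε e e') (d * d') := by
    rintro e e' d d' ⟨h₀, h₁, h₂, h₁₂, h₃, ⟨t, h₁₃⟩, ⟨s, h₂₃⟩, h₁₂₃⟩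
      ⟨h₀', h₁', h₂', h₁₂', h₃', ⟨t', h₁₃'⟩, ⟨s', h₂₃'⟩, h₁₂₃'⟩
    have m₀ : c₀ (d * d') = c₀ d * c₀ d' := rfl
    have m₁ : c₁ (d * d') = c₀ d * c₁ d' + c₁ d * c₀ d' := rfl
    have m₂ : c₂ (d * d') = c₀ d * c₂ d' + c₂ d * c₀ d' := rfl
    have m₃ : c₃ (d * d') = c₀ d * c₃ d' + c₃ d * c₀ d' := rfl
    have m₁₂ : c₁₂ (d * d') = (c₀ d * c₁₂ d' + c₁ d * c₂ d') +
      (c₂ d * c₁ d' + c₁₂ d * c₀ d') := rfl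
    have m₁₃ : c₁₃ (d * d') = (c₀ d * c₁₃ d' + c₁ d * c₃ d') +
      (c₃ d * c₁ d' + c₁₃ d * c₀ d') := rfl
    have m₂₃ : c₂₃ (d * d') = (c₀ d * c₂₃ d' + c₂ d * c₃ d') +
      (c₃ d * c₂ d' + c₂₃ d * c₀ d') := rfl
    have m₁₂₃ : c₁₂₃ (d * d') =
      ((c₀ d * c₁₂₃ d' + c₁ d * c₂₃ d') + (c₂ d * c₁₃ d' + c₁₂ d * c₃ d')) +
      ((c₃ d * c₁₂ d' + c₁₃ d * c₂ d') + (c₂₃ d * c₁ d' + c₁₂₃ d * c₀ d')) := rfl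
    -- Of the six products in the top coefficient, `f` kills the four that pass through `ac` or
    -- `bc`; `(ab)c` and `c(ab)` give the test multiplication.
    have hq' : f (b * c * a) = 0 := by rw [hε, map_smul, hq, smul_zero]
    have hr' : f (a * c * b) = 0 := by rw [hε, map_smul, hr, smul_zero]
    have hp' : f (c * (a * b)) = ε * f (a * b * c) := by rw [hε, map_smul, smul_eq_mul]
    refine ⟨?_, ?_, ?_, ?_, ?_,
      ⟨e.1.1 * e'.2.1 + ε * (e.2.1 * e'.1.1), ?_⟩,
      ⟨e.1.2.1 * e'.2.1 + ε * (e.2.1 * e'.1.2.1), ?_⟩, ?_⟩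
    · rw [m₀, h₀, zero_mul]
    · rw [m₁, h₀, h₀', zero_mul, mul_zero]; simp [testMul]
    · rw [m₂, h₀, h₀', zero_mul, mul_zero]; simp [testMul]
    · rw [m₁₂, h₀, h₀', h₁, h₂, h₁', h₂', zero_mul, mul_zero, smul_mul_smul_comm,
        smul_mul_smul_comm, hε b a]
      simp [testMul, add_smul, smul_smul, mul_comm]
    · rw [m₃, h₀, h₀', zero_mul, mul_zero]; simp [testMul]
    · rw [m₁₃, h₀, h₀', h₁, h₃, h₁', h₃', zero_mul, mul_zero, smul_mul_smul_comm,
        smul_mul_smul_comm, hε c a]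
      simp [add_smul, smul_smul, mul_comm]
    · rw [m₂₃, h₀, h₀', h₂, h₃, h₂', h₃', zero_mul, mul_zero, smul_mul_smul_comm,
        smul_mul_smul_comm, hε c b]
      simp [add_smul, smul_smul, mul_comm]
    · rw [m₁₂₃, h₀, h₀', h₁, h₁', h₂, h₂', h₃, h₃', h₁₂, h₁₂', h₁₃, h₁₃', h₂₃, h₂₃']
      simp only [smul_mul_smul_comm, map_add, map_smul, hq, hr, hq', hr', hp', zero_mul, mul_zero,
        map_zero, smul_eq_mul, testMul, LinearMap.mk₂_apply]
      ring
  let R : NonUnitalSubalgebra F (E × D) :=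
    { carrier := {z | P z.1 z.2}
      add_mem' := fun {z z'} h h' => P_add z.1 z'.1 z.2 z'.2 h h'
      zero_mem' := P_zero
      mul_mem' := fun {z z'} h h' => P_mul z.1 z'.1 z.2 z'.2 h h'
      smul_mem' := fun r z h => P_smul r z.1 z.2 h }
  refine hV.of_rel (hV.dual (hV.dual (hV.dual hA))) R (fun e => ?_) (fun e he => ?_)
  · let e' : W := e
    let d : ((A × A) × (A × A)) × ((A × A) × (A × A)) :=
      (((0, e'.1.1 • a), (e'.1.2.1 • b, e'.1.2.2 • (a * b))),
        ((e'.2.1 • c, 0), (0, e'.2.2 • (a * b * c))))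
    exact ⟨d, rfl, rfl, rfl, rfl, rfl, ⟨0, (zero_smul _ _).symm⟩, ⟨0, (zero_smul _ _).symm⟩,
      map_smul f _ _⟩
  · obtain ⟨-, h₁, h₂, h₁₂, h₃, -, -, h₁₂₃⟩ := he
    rw [map_zero] at h₁ h₂ h₁₂ h₃ h₁₂₃
    rw [map_zero] at h₁₂₃
    exact Prod.ext (Prod.ext ((smul_eq_zero.1 h₁.symm).resolve_right ha0)
      (Prod.ext ((smul_eq_zero.1 h₂.symm).resolve_right hb0)
        ((smul_eq_zero.1 h₁₂.symm).resolve_right hab0)))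
      (Prod.ext ((smul_eq_zero.1 h₃.symm).resolve_right hc0)
        ((mul_eq_zero.1 h₁₂₃.symm).resolve_right hf))

/-! ### From membership in a span to identities of degree three -/

/-- In an action accessible variety of `ε`-commutative algebras, the products `(ab)c` are given
uniformly by linear combinations of the products `a(bc)` and `b(ac)`, for all permutations of a
given triple of elements. -/
theorem exists_forall_mul_mul_eq (hV : IsOperadicVariety.{w} V)
    (hacc : IsActionAccessible V.FullSubcategory) (ε : F)
    (hε : ∀ A, V A → ∀ x y : A, x * y = ε • (y * x)) {A : NAAlg F} (hA : V A) (v : Fin 3 → A) :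
    ∃ l m : F, ∀ σ : Equiv.Perm (Fin 3), v (σ 0) * v (σ 1) * v (σ 2) =
      l • (v (σ 0) * (v (σ 1) * v (σ 2))) + m • (v (σ 1) * (v (σ 0) * v (σ 2))) := by
  let ι := ULift.{u} (Equiv.Perm (Fin 3))
  have hP : V ⟨ι → A⟩ := hV.pi fun _ => hA
  -- One span membership in the power over all permutations yields the same `l, m` in every
  -- coordinate.
  let w : Fin 3 → ι → A := fun n σ => v (σ.down n)
  have h : w 0 * w 1 * w 2 ∈
      Submodule.span F {w 0 * (w 1 * w 2), w 1 * (w 0 * w 2)} := by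
    by_contra h
    exact not_test_of_isActionAccessible hV hacc ε
      (test_of_notMem_span (A := ⟨ι → A⟩) hV hP ε (hε _ hP) (w 0) (w 1) (w 2) h)
  obtain ⟨l, m, hlm⟩ := Submodule.mem_span_pair.1 h
  exact ⟨l, m, fun σ => (congrFun hlm ⟨σ⟩).symm⟩

/-- If `l ≠ m`, comparing the two expressions for `p`, and likewise for `q`, gives `p = q = r`. If
`l = m`, differences are killed by `1 + l`, and for `l = -1` the first relation is the vanishing
sum. -/
theorem eq_or_add_eq_zero {M : Type*} [AddCommGroup M] [Module F M] {p q r : M} {l m : F}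
    (h₁ : p = l • q + m • r) (h₂ : p = m • q + l • r) (h₃ : q = l • r + m • p)
    (h₄ : q = m • r + l • p) (h₅ : r = l • p + m • q) : p = q ∨ p + q + r = 0 := by
  by_cases hlm : l = m
  · subst hlm
    have hpq : (1 + l) • (p - q) = 0 := by linear_combination (norm := module) h₁ - h₃
    have hpr : (1 + l) • (p - r) = 0 := by linear_combination (norm := module) h₁ - h₅
    by_cases hl : 1 + l = 0
    · right
      have : l = -1 := by linear_combination hl
      subst this
      linear_combination (norm := module) h₁
    · exact .inl (sub_eq_zero.1 ((smul_eq_zero.1 hpq).resolve_left hl))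
  · have hl : l - m ≠ 0 := sub_ne_zero.2 hlm
    have hqr : (l - m) • (q - r) = 0 := by linear_combination (norm := module) h₂ - h₁
    have hrp : (l - m) • (r - p) = 0 := by linear_combination (norm := module) h₄ - h₃
    have h₆ := sub_eq_zero.1 ((smul_eq_zero.1 hqr).resolve_left hl)
    have h₇ := sub_eq_zero.1 ((smul_eq_zero.1 hrp).resolve_left hl)
    exact .inl (h₇.symm.trans h₆.symm)

/-- By `ε`-commutativity every product of the three elements is, up to `ε`, one of `(ab)c, (bc)a,
(ca)b`. Even orderings give these cyclic relations with coefficients `lε, m` (`key`), odd ones with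
the two exchanged (`key'`). -/
theorem mul_mul_eq_or_add_eq_zero (hV : IsOperadicVariety.{w} V)
    (hacc : IsActionAccessible V.FullSubcategory) (ε : F) (hεε : ε * ε = 1)
    (hε : ∀ A, V A → ∀ x y : A, x * y = ε • (y * x)) {A : NAAlg F} (hA : V A) (a b c : A) :
    a * b * c = b * c * a ∨ a * b * c + b * c * a + c * a * b = 0 := by
  obtain ⟨l, m, h⟩ := exists_forall_mul_mul_eq hV hacc ε hε hA ![a, b, c]
  have key : ∀ x y z : A, (x * y * z = l • (x * (y * z)) + m • (y * (x * z))) →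
      x * y * z = (l * ε) • (y * z * x) + m • (z * x * y) := fun x y z h => by
    rw [h, hε A hA x (y * z), hε A hA y (x * z), hε A hA x z, smul_mul_assoc, smul_smul,
      smul_smul ε ε, hεε, one_smul]
  have swap : ∀ x y z : A, y * x * z = ε • (x * y * z) := fun x y z => by
    rw [hε A hA y x, smul_mul_assoc]
  have key' : ∀ x y z : A, (y * x * z = l • (y * (x * z)) + m • (x * (y * z))) →
      x * y * z = m • (y * z * x) + (l * ε) • (z * x * y) := fun x y z h => by
    have := key y x z h
    rw [swap x y z, swap z x y, swap y z x] at this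
    have h2 := congrArg (ε • ·) this
    simp only [smul_add, smul_smul, hεε, one_smul] at h2
    rw [h2, add_comm]
    congr 2
    · linear_combination m * hεε
    · linear_combination (l * ε) * hεε
  have h₁ := key a b c (by simpa using h 1)
  have h₂ := key' a b c (by
    simpa [show (Equiv.swap 0 1 : Equiv.Perm (Fin 3)) 2 = 2 by decide] using h (Equiv.swap 0 1))
  have h₃ := key b c a (by simpa [show finRotate 3 2 = 0 by decide] using h (finRotate 3))
  have h₄ := key' b c a (by
    simpa [show (Equiv.swap 0 2 : Equiv.Perm (Fin 3)) 1 = 1 by decide] using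
      h (Equiv.swap 0 2))
  have h₅ := key c a b (by
    have := h (finRotate 3).symm
    simpa [show (finRotate 3).symm 0 = 2 by decide, show (finRotate 3).symm 1 = 0 by decide,
      show (finRotate 3).symm 2 = 1 by decide] using this)
  exact eq_or_add_eq_zero h₁ h₂ h₃ h₄ h₅

/-- Counterexamples to the two alternatives, in `A` and in `B`, would combine to a triple in `A × B`
violating both. -/
theorem forall_mul_mul_eq_or_forall_add_eq_zero (hV : IsOperadicVariety.{w} V)
    (hacc : IsActionAccessible V.FullSubcategory) (ε : F) (hεε : ε * ε = 1)
    (hε : ∀ A, V A → ∀ x y : A, x * y = ε • (y * x)) :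
    (∀ A, V A → ∀ a b c : A, a * b * c = b * c * a) ∨
      ∀ A, V A → ∀ a b c : A, a * b * c + b * c * a + c * a * b = 0 := by
  by_contra! ⟨⟨A, hA, a, b, c, h⟩, ⟨B, hB, a', b', c', h'⟩⟩
  rcases mul_mul_eq_or_add_eq_zero hV hacc ε hεε hε (hV.prod hA hB) ((a, a') : A × B) (b, b')
    (c, c') with h₀ | h₀
  · exact h (congrArg Prod.fst h₀)
  · exact h' (congrArg Prod.snd h₀)

end NAAlg

theorem mainTheorem8 {F : Type u} [Field F] (V : ObjectProperty (NAAlg F))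
    (hOperadic : IsOperadicVariety.{w} V)
    (hNonAbelian : V ≠ AbAlg F)
    (hAccessible : IsActionAccessible V.FullSubcategory) :
    (V ≤ Com F → V ≤ CAssoc F ∨ V ≤ JJord F) ∧
      (V ≤ ACom F → V ≤ LieVar F ∨ V ≤ ACAAssoc F) := by
  refine ⟨fun hV => ?_, fun hV => ?_⟩
  · rcases NAAlg.forall_mul_mul_eq_or_forall_add_eq_zero hOperadic hAccessible 1 (one_mul 1)
      (fun A hA x y => by rw [one_smul]; exact hV A hA x y) with h | h
    -- Cyclic invariance gives `(xy)z = (yz)x`, which is `x(yz)` by commutativity; in the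
    -- anti-commutative case a sign appears.
    · exact .inl fun A hA => ⟨hV A hA, fun x y z => by rw [h A hA x y z, hV A hA x]⟩
    · refine .inr fun A hA => ⟨hV A hA, fun x y z => ?_⟩
      rw [hV A hA x (y * z), hV A hA y (z * x), hV A hA z (x * y), ← h A hA x y z]
      abel
  · rcases NAAlg.forall_mul_mul_eq_or_forall_add_eq_zero hOperadic hAccessible (-1) (by simp)
      (fun A hA x y => by rw [neg_one_smul]; exact hV A hA x y) with h | h
    · exact .inr fun A hA => ⟨hV A hA, fun x y z => by rw [h A hA x y z, hV A hA x]⟩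
    · refine .inl fun A hA => ⟨fun x y => ?_, fun x y z => ?_⟩
      · rw [hV A hA x y, neg_add_cancel]
      · rw [hV A hA x (y * z), hV A hA y (z * x), hV A hA z (x * y), ← neg_zero (G := A),
          ← h A hA x y z]
        abel
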